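/- Let $\mathsf{Vars}$ be a finite set of program variables, let $\mathsf{States}=\mathbb{N}^{\mathsf{Vars}}$, and let $\vec X=(X_v)_{v\in\mathsf{Vars}}$ be indeterminates. A measure $\mu$ on $\mathsf{States}$ is identified with its generating function $\sum_{s}\mu(s)\vec X^{s}\in\mathbb{R}_{\ge 0}^{\infty}[[\vec X]]$. For a power series $\mathfrak g$ write $\mathfrak g_{v<n}=\sum_{i<n}\frac1{i!}(\partial_{X_v}^i\mathfrak g)[X_v/0]\,X_v^i$, the part of $\mathfrak g$ consisting of the terms whose exponent of $X_v$ is less than $n$. A series has a \emph{rational closed form} if all its coefficients are finite and it equals $N\cdot D^{-1}$ in $\mathbb{R}[[\vec X]]$ for polynomials $N,D\in\mathbb{R}[\vec X]$ with $D$ invertible in $\mathbb{R}[[\vec X]]$. A \emph{clReDiP} program is built from decrements $v\texttt{--}$ (truncated at $0$), increments $v \mathrel{+}= \mathrm{iid}(D,y)$ (add to $v$ the sum of $y$-many independent samples of a probability distribution $D$ on $\mathbb{N}$ whose generating function $[\![D]\!](T)=\sum_m D(m)T^m$ has a rational closed form), sequential composition, and branching on guards $v<n$; it has no loops and no constant assignments.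 Its generating function semantics $\mathrm{pm}[\![\cdot]\!]$ is $$\mathrm{pm}[\![v\texttt{--}]\!](\mathfrak g)=(\mathfrak g-\mathfrak g_{v<1})X_v^{-1}+\mathfrak g_{v<1},\qquad \mathrm{pm}[\![v\mathrel{+}=\mathrm{iid}(D,y)]\!](\mathfrak g)=\mathfrak g\bigl[X_y/\,X_y\cdot[\![D]\!](X_v)\bigr],$$ $$\mathrm{pm}[\![\mathtt{if}\,(v<n)\,P_1\,\mathtt{else}\,P_2]\!](\mathfrak g)=\mathrm{pm}[\![P_1]\!](\mathfrak g_{v<n})+\mathrm{pm}[\![P_2]\!](\mathfrak g-\mathfrak g_{v<n}),\qquad \mathrm{pm}[\![P_1;P_2]\!](\mathfrak g)=\mathrm{pm}[\![P_2]\!](\mathrm{pm}[\![P_1]\!](\mathfrak g)).$$ These operations are used on $\mathbb{R}_{\ge0}^{\infty}[[\vec X]]$ (where $\mathfrak g-\mathfrak g_{v<n}$ keeps exactly the coefficients in which $\mathfrak g$ and $\mathfrak g_{v<n}$ differ) and equally on the ring $\mathbb{R}[[\vec X]]$. Let $P=\mathtt{while}\,(v<n)\,\{P_0\}$ with a clReDiP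 body $P_0$, and let $\mu$ be a measure on $\mathsf{States}$ whose generating function $\mathfrak g_\mu$ has a rational closed form. Let $\mathcal T$ be a finite set of parameters, let $I=N/D$ be a rational template, i.e. a formal fraction of polynomials $N,D\in(\mathbb{R}[\mathcal T])[\vec X]$, and let $\tau\colon\mathcal T\to\mathbb{R}$ be such that $I[\tau]=N[\tau]\cdot D[\tau]^{-1}$ is well-defined, i.e. $D[\tau]$ is invertible in $\mathbb{R}[[\vec X]]$. Suppose that, in $\mathbb{R}[[\vec X]]$, $$\Phi_{\mathfrak g_\mu}^{P}(I[\tau])\;:=\;\mathfrak g_\mu+\mathrm{pm}[\![P_0]\!]\bigl((I[\tau])_{v<n}\bigr)\;=\;I[\tau].$$ \textbf{Theorem.} If all coefficients of $I[\tau]$ are nonnegative, then the measure $\mu_{I[\tau]}$, which assigns to a state $s$ the coefficient of $\vec X^{s}$ in $I[\tau]$, is an occupation invariant of $\mathtt{while}\,(v<n)\,\{P_0\}$ with respect to $\mu$, that is, $$\mu+\mathrm{pm}[\![P_0]\!]\bigl([v<n]\cdot\mu_{I[\tau]}\bigr)=\mu_{I[\tau]},$$ where $[v<n]\cdot\nu$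 is the restriction of $\nu$ to the states satisfying $v<n$. This holds both when $\mathrm{pm}[\![P_0]\!](\nu)$ is the posterior measure of $P_0$, viewed as a pGCL program, on the initial measure $\nu$ (the state-wise measure transformer semantics), and when it is given by the generating function semantics on $\mathbb{R}_{\ge0}^{\infty}[[\vec X]]$. -/

import Mathlib

open scoped ENNReal

noncomputable section

/-- Program states over a set `V` of program variables. The set of variables is finite wherever
states are used below, so that finitely supported functions are all functions `V → ℕ`. -/
abbrev State (V : Type*) : Type _ := V →₀ ℕ

/-- Measures on the countable set of states, identified with their point masses. -/
abbrev StateMeasure (V : Type*) : Type _ := State V → ℝ≥0∞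

/-- Least fixed point of a (monotone) functional on the complete lattice `α → ℝ≥0∞`
(Knaster-Tarski: the infimum of all pre-fixed points). -/
def leastFixedPoint {α : Type*} (F : (α → ℝ≥0∞) → (α → ℝ≥0∞)) : α → ℝ≥0∞ :=
  sInf {ν | F ν ≤ ν}

/-! ### pGCL, posterior measures and occupation invariants -/

/-- The probabilistic guarded command language. -/
inductive PGCL (V : Type*) : Type _
  | skip : PGCL V
  | diverge : PGCL V
  | assign (x : V) (E : State V → ℕ) : PGCL V
  | sample (x : V) (D : State V → PMF ℕ) : PGCL V
  | choice (C₁ : PGCL V) (p : Set.Icc (0 : ℚ) 1) (C₂ : PGCL V) : PGCL V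
  | seq (C₁ C₂ : PGCL V) : PGCL V
  | ite (φ : Set (State V)) (C₁ C₂ : PGCL V) : PGCL V
  | while (φ : Set (State V)) (C₀ : PGCL V) : PGCL V

open Classical in
/-- The posterior measure `pm⟦C⟧(g)` of a program with respect to an initial measure. The measure
`[φ] · g` is `φ.indicator g`. -/
def PGCL.pm {V : Type*} : PGCL V → StateMeasure V → StateMeasure V
  | .skip, g => g
  | .diverge, _ => 0
  | .assign x E, g => fun s => ∑' s', (if s'.update x (E s') = s then 1 else 0) * g s'
  | .sample x D, g => fun s =>
      ∑' s', (if s'.update x (s x) = s then 1 else 0) * D s' (s x) * g s'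
  | .choice C₁ p C₂, g =>
      C₁.pm (fun s => ENNReal.ofReal ((p : ℚ) : ℝ) * g s) +
        C₂.pm (fun s => ENNReal.ofReal (1 - ((p : ℚ) : ℝ)) * g s)
  | .seq C₁ C₂, g => C₂.pm (C₁.pm g)
  | .ite φ C₁ C₂, g => C₁.pm (φ.indicator g) + C₂.pm (φᶜ.indicator g)
  | .while φ C₀, g => φᶜ.indicator (leastFixedPoint fun ν => g + C₀.pm (φ.indicator ν))

/-- The characteristic function of the loop `while φ {C₀}` with respect to `g`. -/
def PGCL.charFun {V : Type*} (φ : Set (State V)) (C₀ : PGCL V) (g ν : StateMeasure V) :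
    StateMeasure V :=
  g + C₀.pm (φ.indicator ν)

/-- `I` is an occupation invariant of `while φ {C₀}` with respect to the initial measure `g`. -/
def PGCL.IsOccupationInvariant {V : Type*} (φ : Set (State V)) (C₀ : PGCL V)
    (g I : StateMeasure V) : Prop :=
  PGCL.charFun φ C₀ g I = I

/-! ### Operations on formal power series

They are used over `ℝ≥0∞` and over `ℝ`. -/

namespace FPS

variable {V R : Type*}

open Classical in
/-- Substitution `g[X_v / h]`. The inner sum is an infinite sum in general. If `h` has no constant
term, then it has only finitely many nonzero terms. -/
def substVar [CommSemiring R] [TopologicalSpace R] (v : V) (g h : MvPowerSeries V R) :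
    MvPowerSeries V R :=
  fun s => ∑ p ∈ (Finset.HasAntidiagonal.antidiagonal s).filter (fun p => p.2 v = s v),
    ∑' k : ℕ, MvPowerSeries.coeff (p.1.update v k) g * MvPowerSeries.coeff p.2 (h ^ k)

/-- Downward shifting `g · X_v⁻¹`. -/
def shiftDown [CommSemiring R] (v : V) (g : MvPowerSeries V R) : MvPowerSeries V R :=
  fun s => MvPowerSeries.coeff (s.update v (s v + 1)) g

/-- Formal derivative with respect to `X_v`. -/
def pderiv [CommSemiring R] (v : V) (g : MvPowerSeries V R) : MvPowerSeries V R :=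
  fun s => ((s v : R) + 1) * MvPowerSeries.coeff (s.update v (s v + 1)) g

/-- Restriction `g_{v < n} = ∑_{i < n} (1 / i!) (∂^i g / ∂X_v^i)[X_v / 0] X_v^i`. -/
def restrict [CommSemiring R] [Inv R] [TopologicalSpace R] (v : V) (n : ℕ)
    (g : MvPowerSeries V R) : MvPowerSeries V R :=
  ∑ i ∈ Finset.range n,
    MvPowerSeries.C ((i.factorial : R)⁻¹) * substVar v ((pderiv v)^[i] g) 0 *
      MvPowerSeries.X v ^ i

open Classical in
/-- The difference `g - g_{v < n}` over `ℝ≥0∞`, where no subtraction is available. -/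
def restrictCompl (v : V) (n : ℕ) (g : MvPowerSeries V ℝ≥0∞) : MvPowerSeries V ℝ≥0∞ :=
  fun s => if MvPowerSeries.coeff s g ≠ MvPowerSeries.coeff s (restrict v n g)
    then MvPowerSeries.coeff s g else 0

open Classical in
/-- The univariate series `∑_m d(m) X_v^m`. -/
def univariate [CommSemiring R] (v : V) (d : ℕ → R) : MvPowerSeries V R :=
  fun s => if s = Finsupp.single v (s v) then d (s v) else 0

/-- Generating function of a measure. -/
def ofMeasure (μ : StateMeasure V) : MvPowerSeries V ℝ≥0∞ := fun s => μ s

/-- Measure defined by a generating function. -/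
def toMeasure (g : MvPowerSeries V ℝ≥0∞) : StateMeasure V := fun s => MvPowerSeries.coeff s g

/-- The embedding into `ℝ⟦X⟧` of those series over `ℝ≥0∞` that have no coefficient `∞`. -/
def toReal (g : MvPowerSeries V ℝ≥0∞) : MvPowerSeries V ℝ :=
  fun s => (MvPowerSeries.coeff s g).toReal

/-- A real series with nonnegative coefficients, regarded as a series over `ℝ≥0∞`. -/
def ofReal (g : MvPowerSeries V ℝ) : MvPowerSeries V ℝ≥0∞ :=
  fun s => ENNReal.ofReal (MvPowerSeries.coeff s g)

/-- `g` has finite coefficients and a rational closed form `N / D`, where `N` and `D` are real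
polynomials and `D` is invertible in `ℝ⟦X⟧`. -/
def HasRationalClosedForm (g : MvPowerSeries V ℝ≥0∞) : Prop :=
  (∀ s, MvPowerSeries.coeff s g ≠ ∞) ∧
    ∃ N D : MvPolynomial V ℝ, IsUnit (D : MvPowerSeries V ℝ) ∧
      toReal g = (N : MvPowerSeries V ℝ) * (D : MvPowerSeries V ℝ)⁻¹

end FPS

/-- The generating function of a distribution on `ℕ` has a rational closed form. -/
def HasRationalGF (D : PMF ℕ) : Prop :=
  ∃ p q : Polynomial ℝ, IsUnit (q : PowerSeries ℝ) ∧
    PowerSeries.mk (fun m => (D m).toReal) = (p : PowerSeries ℝ) * (q : PowerSeries ℝ)⁻¹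

/-! ### ReDiP and its generating function semantics -/

/-- Rectangular discrete probabilistic programs: `v := n`, `v--`, `v += iid(D, y)`,
`if (v < n) {P₁} else {P₂}`, `P₁; P₂` and `while (v < n) {P₁}`. -/
inductive ReDiP (V : Type*) : Type _
  | assign (v : V) (n : ℕ) : ReDiP V
  | decr (v : V) : ReDiP V
  | incr (v : V) (D : PMF ℕ) (y : V) : ReDiP V
  | ite (v : V) (n : ℕ) (P₁ P₂ : ReDiP V) : ReDiP V
  | seq (P₁ P₂ : ReDiP V) : ReDiP V
  | while (v : V) (n : ℕ) (P₁ : ReDiP V) : ReDiP V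

namespace ReDiP

variable {V : Type*}

open FPS

/-- The law of the sum of `k` independent samples from `D`. -/
def iidSum (D : PMF ℕ) : ℕ → PMF ℕ
  | 0 => PMF.pure 0
  | k + 1 => (iidSum D k).bind fun a => D.map fun b => a + b

/-- ReDiP as a fragment of pGCL. -/
def toPGCL : ReDiP V → PGCL V
  | .assign v n => .assign v fun _ => n
  | .decr v => .assign v fun s => s v - 1
  | .incr v D y => .sample v fun s => (iidSum D (s y)).map fun b => s v + b
  | .ite v n P₁ P₂ => .ite {s | s v < n} P₁.toPGCL P₂.toPGCL
  | .seq P₁ P₂ => .seq P₁.toPGCL P₂.toPGCL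
  | .while v n P₁ => .while {s | s v < n} P₁.toPGCL

/-- The generating function semantics over `ℝ≥0∞⟦X⟧`. -/
def gfPm : ReDiP V → MvPowerSeries V ℝ≥0∞ → MvPowerSeries V ℝ≥0∞
  | .assign v n, g => substVar v g 1 * MvPowerSeries.X v ^ n
  | .decr v, g => shiftDown v (restrictCompl v 1 g) + restrict v 1 g
  | .incr v D y, g => substVar y g (MvPowerSeries.X y * univariate v fun m => D m)
  | .ite v n P₁ P₂, g => P₁.gfPm (restrict v n g) + P₂.gfPm (restrictCompl v n g)
  | .seq P₁ P₂, g => P₂.gfPm (P₁.gfPm g)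
  | .while v n P₁, g =>
      restrictCompl v n (leastFixedPoint (α := State V) fun i => g + P₁.gfPm (restrict v n i))

/-- The characteristic functional of `while (v < n) {P₀}` over `ℝ≥0∞⟦X⟧`. -/
def gfCharFun (v : V) (n : ℕ) (P₀ : ReDiP V) (g i : MvPowerSeries V ℝ≥0∞) :
    MvPowerSeries V ℝ≥0∞ :=
  g + P₀.gfPm (restrict v n i)

/-- Closed ReDiP: no loops, no constant assignments, and every distribution that is used has a
rational closed form. -/
def IsClosed : ReDiP V → Prop
  | .assign _ _ => False
  | .decr _ => True
  | .incr _ D _ => HasRationalGF D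
  | .ite _ _ P₁ P₂ => P₁.IsClosed ∧ P₂.IsClosed
  | .seq P₁ P₂ => P₁.IsClosed ∧ P₂.IsClosed
  | .while _ _ _ => False

/-- The semantics of closed ReDiP programs over the ring `ℝ⟦X⟧`, in which closed forms live. The
series substituted in an increment has no constant term. -/
def realPm : (P : ReDiP V) → P.IsClosed → MvPowerSeries V ℝ → MvPowerSeries V ℝ
  | .assign _ _, h, _ => h.elim
  | .decr v, _, g => shiftDown v (g - restrict v 1 g) + restrict v 1 g
  | .incr v D y, _, g => substVar y g (MvPowerSeries.X y * univariate v fun m => (D m).toReal)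
  | .ite v n P₁ P₂, h, g =>
      P₁.realPm h.1 (restrict v n g) + P₂.realPm h.2 (g - restrict v n g)
  | .seq P₁ P₂, h, g => P₂.realPm h.2 (P₁.realPm h.1 g)
  | .while _ _ _, h, _ => h.elim

/-- The characteristic functional of `while (v < n) {P₀}`, `P₀` closed, over `ℝ⟦X⟧`. -/
def realCharFun (v : V) (n : ℕ) (P₀ : ReDiP V) (h : P₀.IsClosed) (g i : MvPowerSeries V ℝ) :
    MvPowerSeries V ℝ :=
  g + P₀.realPm h (restrict v n i)

end ReDiP

/-! ### Rational templates -/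

/-- A formal fraction of polynomials in the program variables `V` whose coefficients are real
polynomials in the parameters `T`. -/
structure RationalTemplate (V T : Type*) where
  num : MvPolynomial V (MvPolynomial T ℝ)
  den : MvPolynomial V (MvPolynomial T ℝ)

namespace RationalTemplate

variable {V T : Type*}

/-- Replace every parameter `t` by `τ t` in a polynomial. -/
def instPoly (τ : T → ℝ) (p : MvPolynomial V (MvPolynomial T ℝ)) : MvPolynomial V ℝ :=
  MvPolynomial.map (MvPolynomial.eval τ) p

/-- The instantiation at `τ` is well-defined: its denominator is invertible in `ℝ⟦X⟧`. -/
def IsWellDefinedAt (I : RationalTemplate V T) (τ : T → ℝ) : Prop :=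
  IsUnit (instPoly τ I.den : MvPowerSeries V ℝ)

/-- The instantiation `I[τ]` in `ℝ⟦X⟧`. -/
def inst (I : RationalTemplate V T) (τ : T → ℝ) : MvPowerSeries V ℝ :=
  (instPoly τ I.num : MvPowerSeries V ℝ) * (instPoly τ I.den : MvPowerSeries V ℝ)⁻¹

end RationalTemplate

end

/-!
The theorem transports the fixed point equation from `ℝ⟦X⟧` to `ℝ≥0∞⟦X⟧`, and from there to
measures.

The operations in the semantics are given by formulas that involve derivatives, inverse factorials
and infinite sums. Coefficientwise they are simple: `g_{v < n}` is a truncation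
(`FPS.coeff_restrict`), and the sum in the substitution of `X_y * f` for `X_y` is finite
(`FPS.coeff_substVar_X_mul`). Hence closed programs preserve nonnegativity of real series, and
embedding nonnegative real series into `ℝ≥0∞⟦X⟧` commutes with the two semantics
(`ReDiP.ofReal_realPm`). Since `μ` has finite masses and `I[τ]` is nonnegative, applying the
embedding to the equation for `I[τ]` gives the equation over `ℝ≥0∞⟦X⟧`.

On closed programs the semantics over `ℝ≥0∞⟦X⟧` is the posterior measure, for every initial measure
(`ReDiP.pm_toPGCL_eq_gfPm`). The essential case is the increment (`ReDiP.pm_incr`): the powers of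
the generating function of `D` are the generating functions of sums of independent samples
(`FPS.univariate_pow`).
-/

namespace FPS

variable {V R : Type*}

/-! ### Coefficients of restrictions and shifts -/

theorem coeff_substVar_zero [CommSemiring R] [TopologicalSpace R] (v : V)
    (g : MvPowerSeries V R) (s : State V) :
    MvPowerSeries.coeff s (substVar v g 0) = if s v = 0 then MvPowerSeries.coeff s g else 0 := by
  classical
  have hterm (p : State V × State V) :
      ∑' k : ℕ, MvPowerSeries.coeff (p.1.update v k) g *
        MvPowerSeries.coeff p.2 ((0 : MvPowerSeries V R) ^ k) =
      if p.2 = 0 then MvPowerSeries.coeff (p.1.update v 0) g else 0 := by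
    rw [tsum_eq_single 0 (fun k hk => by simp [zero_pow hk])]
    simp [MvPowerSeries.coeff_one]
  change ∑ p ∈ _, _ = _
  simp only [hterm]
  rw [← Finset.sum_filter]
  split_ifs with hs
  · rw [Finset.sum_eq_single (s, 0)]
    · rw [← hs, Finsupp.update_self]
    · rintro ⟨a, b⟩ hp hne
      simp only [Finset.mem_filter] at hp
      obtain ⟨⟨h1, -⟩, rfl⟩ := hp
      exact absurd (by simpa using h1) (by simpa using hne)
    · intro h
      simp [hs] at h
  · refine Finset.sum_eq_zero fun p hp => ?_
    simp only [Finset.mem_filter] at hp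
    exact absurd hp.1.2.symm (by simpa [hp.2] using hs)

theorem coeff_iterate_pderiv [CommSemiring R] (v : V) (i : ℕ) (g : MvPowerSeries V R)
    (s : State V) :
    MvPowerSeries.coeff s ((pderiv v)^[i] g) =
      ((s v + 1).ascFactorial i : R) * MvPowerSeries.coeff (s.update v (s v + i)) g := by
  classical
  induction i generalizing s with
  | zero => simp
  | succ i ih =>
    rw [Function.iterate_succ_apply']
    change ((s v : R) + 1) * MvPowerSeries.coeff _ _ = _
    rw [ih]
    have h : (s v + 1) * (s v + 1 + 1).ascFactorial i = (s v + 1).ascFactorial (i + 1) := by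
      rw [Nat.ascFactorial_succ, ← Nat.succ_ascFactorial]
    rw [← h]
    simp [Finsupp.update_apply, mul_assoc, add_assoc, add_comm 1 i]

/-- The Taylor-coefficient definition of `g_{v < n}` really truncates `g`, provided factorials
are cancelled by their inverses. -/
theorem coeff_restrict [CommSemiring R] [Inv R] [TopologicalSpace R]
    (hR : ∀ i : ℕ, (i.factorial : R)⁻¹ * i.factorial = 1) (v : V) (n : ℕ)
    (g : MvPowerSeries V R) (s : State V) :
    MvPowerSeries.coeff s (restrict v n g) =
      if s v < n then MvPowerSeries.coeff s g else 0 := by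
  classical
  have hterm (i : ℕ) : MvPowerSeries.coeff s (MvPowerSeries.C ((i.factorial : R)⁻¹) *
      substVar v ((pderiv v)^[i] g) 0 * MvPowerSeries.X v ^ i) =
      if s v = i then MvPowerSeries.coeff s g else 0 := by
    rw [MvPowerSeries.X_pow_eq, MvPowerSeries.coeff_mul_monomial, MvPowerSeries.coeff_C_mul,
      coeff_substVar_zero, coeff_iterate_pderiv]
    simp only [Finsupp.single_le_iff]
    by_cases h : s v = i
    · subst h
      have hupd : (s - Finsupp.single v (s v)).update v (s v) = s := by
        ext w
        by_cases hw : w = v <;> simp [Finsupp.update_apply, hw]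
      simp [hupd, Nat.one_ascFactorial, ← mul_assoc, hR]
    · by_cases h' : i ≤ s v
      · have : s v - i ≠ 0 := by omega
        simp [h, h', this]
      · simp [h, h']
  simp only [restrict, map_sum, hterm]
  simp

theorem coeff_restrict_real (v : V) (n : ℕ) (g : MvPowerSeries V ℝ) (s : State V) :
    MvPowerSeries.coeff s (restrict v n g) =
      if s v < n then MvPowerSeries.coeff s g else 0 :=
  coeff_restrict (fun i => inv_mul_cancel₀ (by exact_mod_cast i.factorial_ne_zero)) v n g s

theorem coeff_restrict_ennreal (v : V) (n : ℕ) (g : MvPowerSeries V ℝ≥0∞) (s : State V) :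
    MvPowerSeries.coeff s (restrict v n g) =
      if s v < n then MvPowerSeries.coeff s g else 0 :=
  coeff_restrict (fun i => ENNReal.inv_mul_cancel (by exact_mod_cast i.factorial_ne_zero)
    (ENNReal.natCast_ne_top _)) v n g s

theorem coeff_restrictCompl (v : V) (n : ℕ) (g : MvPowerSeries V ℝ≥0∞) (s : State V) :
    MvPowerSeries.coeff s (restrictCompl v n g) =
      if s v < n then 0 else MvPowerSeries.coeff s g := by
  change ite _ _ _ = _
  rw [coeff_restrict_ennreal]
  split_ifs <;> simp_all

theorem coeff_shiftDown [CommSemiring R] (v : V) (g : MvPowerSeries V R) (s : State V) :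
    MvPowerSeries.coeff s (shiftDown v g) = MvPowerSeries.coeff (s.update v (s v + 1)) g :=
  rfl

/-! ### Powers of the series substituted by an increment -/

theorem coeff_X_mul_pow_of_lt [CommSemiring R] (y : V) (f : MvPowerSeries V R) {q : State V}
    {k : ℕ} (h : q y < k) : MvPowerSeries.coeff q ((MvPowerSeries.X y * f) ^ k) = 0 := by
  classical
  rw [mul_pow, MvPowerSeries.X_pow_eq, MvPowerSeries.coeff_monomial_mul, if_neg]
  rw [Finsupp.single_le_iff]
  omega

open Classical in
/-- Since `X_y * f` has no constant term, the infinite sum in the substitution is finite. -/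
theorem coeff_substVar_X_mul [CommSemiring R] [TopologicalSpace R] (y : V)
    (g f : MvPowerSeries V R) (s : State V) :
    MvPowerSeries.coeff s (substVar y g (MvPowerSeries.X y * f)) =
      ∑ p ∈ (Finset.HasAntidiagonal.antidiagonal s).filter (fun p => p.2 y = s y),
        ∑ k ∈ Finset.range (s y + 1), MvPowerSeries.coeff (p.1.update y k) g *
          MvPowerSeries.coeff p.2 ((MvPowerSeries.X y * f) ^ k) := by
  refine Finset.sum_congr rfl fun p hp => tsum_eq_sum fun k hk => ?_
  rw [coeff_X_mul_pow_of_lt, mul_zero]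
  simp only [Finset.mem_filter, Finset.mem_range] at hp hk
  omega

theorem coeff_univariate_single [CommSemiring R] (v : V) (d : ℕ → R) (m : ℕ) :
    MvPowerSeries.coeff (Finsupp.single v m) (univariate v d) = d m := by
  rw [MvPowerSeries.coeff_apply, univariate]
  simp

theorem coeff_univariate_eq_zero [CommSemiring R] (v : V) (d : ℕ → R) {s : State V}
    (hs : ∀ m, s ≠ Finsupp.single v m) : MvPowerSeries.coeff s (univariate v d) = 0 :=
  if_neg (hs _)

theorem univariate_mul [CommSemiring R] (v : V) (d e : ℕ → R) :
    univariate v d * univariate v e =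
      univariate v fun n => ∑ p ∈ Finset.HasAntidiagonal.antidiagonal n, d p.1 * e p.2 := by
  classical
  ext s
  rw [MvPowerSeries.coeff_mul]
  by_cases h : ∃ m, s = Finsupp.single v m
  · obtain ⟨m, rfl⟩ := h
    rw [Finsupp.antidiagonal_single, Finset.sum_map, coeff_univariate_single]
    exact Finset.sum_congr rfl fun p _ => congrArg₂ _ (coeff_univariate_single v d _)
      (coeff_univariate_single v e _)
  · push Not at h
    rw [coeff_univariate_eq_zero _ _ h]
    refine Finset.sum_eq_zero fun p hp => ?_
    by_cases h₁ : ∃ a, p.1 = Finsupp.single v a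
    · obtain ⟨a, ha⟩ := h₁
      rw [coeff_univariate_eq_zero v e, mul_zero]
      intro b hb
      refine h (a + b) ?_
      rw [← Finset.HasAntidiagonal.mem_antidiagonal.1 hp, ha, hb, Finsupp.single_add]
    · push Not at h₁
      rw [coeff_univariate_eq_zero v d h₁, zero_mul]

theorem iidSum_succ_apply (D : PMF ℕ) (k m : ℕ) :
    ReDiP.iidSum D (k + 1) m =
      ∑ p ∈ Finset.HasAntidiagonal.antidiagonal m, ReDiP.iidSum D k p.1 * D p.2 := by
  rw [ReDiP.iidSum, PMF.bind_apply, Finset.Nat.sum_antidiagonal_eq_sum_range_succ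
    (fun i j => ReDiP.iidSum D k i * D j), tsum_eq_sum (s := Finset.range (m + 1))]
  · refine Finset.sum_congr rfl fun a ha => ?_
    rw [Finset.mem_range] at ha
    rw [PMF.map_apply, tsum_eq_single (m - a), if_pos (by omega)]
    intro b hb
    rw [if_neg (by omega)]
  · intro a ha
    rw [Finset.mem_range] at ha
    rw [PMF.map_apply]
    exact mul_eq_zero_of_right _ (ENNReal.tsum_eq_zero.2 fun b => if_neg (by omega))

/-- Powers of the generating function of `D` are the generating functions of the sums of
independent samples. -/
theorem univariate_pow (v : V) (D : PMF ℕ) (k : ℕ) :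
    univariate v (fun m => D m) ^ k = univariate v fun m => ReDiP.iidSum D k m := by
  classical
  induction k with
  | zero =>
    ext s
    rw [pow_zero, MvPowerSeries.coeff_one]
    by_cases h : ∃ m, s = Finsupp.single v m
    · obtain ⟨m, rfl⟩ := h
      simp [coeff_univariate_single, ReDiP.iidSum, PMF.pure_apply]
    · push Not at h
      rw [coeff_univariate_eq_zero _ _ h, if_neg fun h0 => h 0 (by simpa using h0)]
  | succ k ih =>
    rw [pow_succ, ih, univariate_mul]
    simp only [iidSum_succ_apply]

theorem coeff_X_mul_univariate_pow (v y : V) (D : PMF ℕ) (k m : ℕ) :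
    MvPowerSeries.coeff (Finsupp.single y k + Finsupp.single v m)
      ((MvPowerSeries.X y * univariate v fun m => D m) ^ k) = ReDiP.iidSum D k m := by
  rw [mul_pow, MvPowerSeries.X_pow_eq, MvPowerSeries.coeff_add_monomial_mul, one_mul,
    univariate_pow, coeff_univariate_single]

theorem coeff_X_mul_univariate_pow_eq_zero (v y : V) (D : PMF ℕ) (k : ℕ) {q : State V}
    (hq : ∀ m, q ≠ Finsupp.single y k + Finsupp.single v m) :
    MvPowerSeries.coeff q ((MvPowerSeries.X y * univariate v fun m => D m) ^ k) = 0 := by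
  classical
  rw [mul_pow, MvPowerSeries.X_pow_eq, MvPowerSeries.coeff_monomial_mul]
  split_ifs with h
  · rw [one_mul, univariate_pow, coeff_univariate_eq_zero]
    intro m hm
    exact hq m (by rw [← hm, add_tsub_cancel_of_le h])
  · rfl

/-! ### Nonnegative real series inside `ℝ≥0∞⟦X⟧` -/

theorem coeff_ofReal (g : MvPowerSeries V ℝ) (s : State V) :
    MvPowerSeries.coeff s (ofReal g) = ENNReal.ofReal (MvPowerSeries.coeff s g) :=
  rfl

theorem coeff_mul_nonneg {f g : MvPowerSeries V ℝ} (hf : ∀ s, 0 ≤ MvPowerSeries.coeff s f)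
    (hg : ∀ s, 0 ≤ MvPowerSeries.coeff s g) (s : State V) :
    0 ≤ MvPowerSeries.coeff s (f * g) := by
  classical
  rw [MvPowerSeries.coeff_mul]
  exact Finset.sum_nonneg fun p _ => mul_nonneg (hf _) (hg _)

theorem coeff_pow_nonneg {f : MvPowerSeries V ℝ} (hf : ∀ s, 0 ≤ MvPowerSeries.coeff s f)
    (k : ℕ) (s : State V) : 0 ≤ MvPowerSeries.coeff s (f ^ k) := by
  classical
  induction k generalizing s with
  | zero =>
    rw [pow_zero, MvPowerSeries.coeff_one]
    split_ifs <;> norm_num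
  | succ k ih =>
    rw [pow_succ]
    exact coeff_mul_nonneg ih hf s

theorem ofReal_add {f g : MvPowerSeries V ℝ} (hf : ∀ s, 0 ≤ MvPowerSeries.coeff s f)
    (hg : ∀ s, 0 ≤ MvPowerSeries.coeff s g) : ofReal (f + g) = ofReal f + ofReal g := by
  ext s
  rw [coeff_ofReal, map_add, map_add, ENNReal.ofReal_add (hf s) (hg s)]
  rfl

theorem ofReal_mul {f g : MvPowerSeries V ℝ} (hf : ∀ s, 0 ≤ MvPowerSeries.coeff s f)
    (hg : ∀ s, 0 ≤ MvPowerSeries.coeff s g) : ofReal (f * g) = ofReal f * ofReal g := by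
  classical
  ext s
  rw [coeff_ofReal, MvPowerSeries.coeff_mul, MvPowerSeries.coeff_mul,
    ENNReal.ofReal_sum_of_nonneg fun p _ => mul_nonneg (hf _) (hg _)]
  exact Finset.sum_congr rfl fun p _ => ENNReal.ofReal_mul (hf _)

theorem ofReal_pow {f : MvPowerSeries V ℝ} (hf : ∀ s, 0 ≤ MvPowerSeries.coeff s f) (k : ℕ) :
    ofReal (f ^ k) = ofReal f ^ k := by
  classical
  induction k with
  | zero =>
    ext s
    rw [coeff_ofReal, pow_zero, pow_zero, MvPowerSeries.coeff_one, MvPowerSeries.coeff_one]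
    split_ifs <;> simp
  | succ k ih => rw [pow_succ, pow_succ, ofReal_mul (coeff_pow_nonneg hf k) hf, ih]

theorem coeff_X_nonneg (y : V) (s : State V) :
    0 ≤ MvPowerSeries.coeff s (MvPowerSeries.X y : MvPowerSeries V ℝ) := by
  classical
  rw [MvPowerSeries.coeff_X]
  split_ifs <;> norm_num

theorem ofReal_X (y : V) : ofReal (MvPowerSeries.X y : MvPowerSeries V ℝ) = MvPowerSeries.X y := by
  classical
  ext s
  rw [coeff_ofReal, MvPowerSeries.coeff_X, MvPowerSeries.coeff_X]
  split_ifs <;> simp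

theorem coeff_univariate_nonneg (v : V) {d : ℕ → ℝ} (hd : ∀ m, 0 ≤ d m) (s : State V) :
    0 ≤ MvPowerSeries.coeff s (univariate v d) := by
  rw [MvPowerSeries.coeff_apply, univariate]
  split_ifs
  · exact hd _
  · rfl

theorem ofReal_univariate (v : V) (D : PMF ℕ) :
    ofReal (univariate v fun m => (D m).toReal) = univariate v fun m => D m := by
  ext s
  rw [coeff_ofReal, MvPowerSeries.coeff_apply, MvPowerSeries.coeff_apply, univariate, univariate]
  split_ifs
  · exact ENNReal.ofReal_toReal (D.apply_ne_top _)
  · exact ENNReal.ofReal_zero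

theorem ofReal_restrict (v : V) (n : ℕ) (g : MvPowerSeries V ℝ) :
    ofReal (restrict v n g) = restrict v n (ofReal g) := by
  ext s
  rw [coeff_ofReal, coeff_restrict_real, coeff_restrict_ennreal, coeff_ofReal]
  split_ifs <;> simp

theorem coeff_restrict_nonneg {g : MvPowerSeries V ℝ} (hg : ∀ s, 0 ≤ MvPowerSeries.coeff s g)
    (v : V) (n : ℕ) (s : State V) : 0 ≤ MvPowerSeries.coeff s (restrict v n g) := by
  rw [coeff_restrict_real]
  split_ifs
  · exact hg s
  · rfl

theorem coeff_sub_restrict (v : V) (n : ℕ) (g : MvPowerSeries V ℝ) (s : State V) :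
    MvPowerSeries.coeff s (g - restrict v n g) =
      if s v < n then 0 else MvPowerSeries.coeff s g := by
  rw [map_sub, coeff_restrict_real]
  split_ifs <;> simp

theorem ofReal_sub_restrict (v : V) (n : ℕ) (g : MvPowerSeries V ℝ) :
    ofReal (g - restrict v n g) = restrictCompl v n (ofReal g) := by
  ext s
  rw [coeff_ofReal, coeff_sub_restrict, coeff_restrictCompl, coeff_ofReal]
  split_ifs <;> simp

theorem coeff_sub_restrict_nonneg {g : MvPowerSeries V ℝ}
    (hg : ∀ s, 0 ≤ MvPowerSeries.coeff s g) (v : V) (n : ℕ) (s : State V) :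
    0 ≤ MvPowerSeries.coeff s (g - restrict v n g) := by
  rw [coeff_sub_restrict]
  split_ifs
  · rfl
  · exact hg s

theorem ofReal_shiftDown (v : V) (g : MvPowerSeries V ℝ) :
    ofReal (shiftDown v g) = shiftDown v (ofReal g) :=
  rfl

theorem coeff_substVar_X_mul_nonneg (y : V) {g f : MvPowerSeries V ℝ}
    (hg : ∀ s, 0 ≤ MvPowerSeries.coeff s g) (hf : ∀ s, 0 ≤ MvPowerSeries.coeff s f)
    (s : State V) :
    0 ≤ MvPowerSeries.coeff s (substVar y g (MvPowerSeries.X y * f)) := by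
  rw [coeff_substVar_X_mul]
  exact Finset.sum_nonneg fun p _ => Finset.sum_nonneg fun k _ =>
    mul_nonneg (hg _) (coeff_pow_nonneg (coeff_mul_nonneg (coeff_X_nonneg y) hf) k _)

theorem ofReal_substVar_X_mul (y : V) {g f : MvPowerSeries V ℝ}
    (hg : ∀ s, 0 ≤ MvPowerSeries.coeff s g) (hf : ∀ s, 0 ≤ MvPowerSeries.coeff s f) :
    ofReal (substVar y g (MvPowerSeries.X y * f)) =
      substVar y (ofReal g) (MvPowerSeries.X y * ofReal f) := by
  have hXf := coeff_mul_nonneg (coeff_X_nonneg y) hf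
  ext s
  rw [coeff_ofReal, coeff_substVar_X_mul, coeff_substVar_X_mul,
    ENNReal.ofReal_sum_of_nonneg fun p _ => Finset.sum_nonneg fun k _ =>
      mul_nonneg (hg _) (coeff_pow_nonneg hXf k _)]
  refine Finset.sum_congr rfl fun p _ => ?_
  rw [ENNReal.ofReal_sum_of_nonneg fun k _ => mul_nonneg (hg _) (coeff_pow_nonneg hXf k _)]
  refine Finset.sum_congr rfl fun k _ => ?_
  rw [ENNReal.ofReal_mul (hg _), ← ofReal_X, ← ofReal_mul (coeff_X_nonneg y) hf,
    ← ofReal_pow hXf, coeff_ofReal, coeff_ofReal]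

theorem ofReal_toReal {g : MvPowerSeries V ℝ≥0∞} (hg : ∀ s, MvPowerSeries.coeff s g ≠ ∞) :
    ofReal (toReal g) = g := by
  ext s
  exact ENNReal.ofReal_toReal (hg s)

end FPS

namespace ReDiP

variable {V : Type*}

open FPS

/-! ### The real semantics agrees with the semantics over `ℝ≥0∞` -/

theorem coeff_realPm_nonneg (P : ReDiP V) (hP : P.IsClosed) {g : MvPowerSeries V ℝ}
    (hg : ∀ s, 0 ≤ MvPowerSeries.coeff s g) (s : State V) :
    0 ≤ MvPowerSeries.coeff s (P.realPm hP g) := by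
  induction P generalizing g s with
  | assign v n => exact hP.elim
  | decr v =>
    rw [realPm, map_add, coeff_shiftDown]
    exact add_nonneg (coeff_sub_restrict_nonneg hg v 1 _) (coeff_restrict_nonneg hg v 1 s)
  | incr v D y =>
    exact coeff_substVar_X_mul_nonneg y hg
      (coeff_univariate_nonneg v fun _ => ENNReal.toReal_nonneg) s
  | ite v n P₁ P₂ ih₁ ih₂ =>
    rw [realPm, map_add]
    exact add_nonneg (ih₁ hP.1 (coeff_restrict_nonneg hg v n) s)
      (ih₂ hP.2 (coeff_sub_restrict_nonneg hg v n) s)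
  | seq P₁ P₂ ih₁ ih₂ => exact ih₂ hP.2 (ih₁ hP.1 hg) s
  | _ => exact hP.elim

theorem ofReal_realPm (P : ReDiP V) (hP : P.IsClosed) {g : MvPowerSeries V ℝ}
    (hg : ∀ s, 0 ≤ MvPowerSeries.coeff s g) :
    ofReal (P.realPm hP g) = P.gfPm (ofReal g) := by
  induction P generalizing g with
  | assign v n => exact hP.elim
  | decr v =>
    have h (s : State V) :
        0 ≤ MvPowerSeries.coeff s (shiftDown v (g - restrict v 1 g)) :=
      coeff_sub_restrict_nonneg hg v 1 _
    rw [realPm, gfPm, FPS.ofReal_add h (coeff_restrict_nonneg hg v 1), ofReal_shiftDown,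
      ofReal_sub_restrict, ofReal_restrict]
  | incr v D y =>
    rw [realPm, gfPm, ofReal_substVar_X_mul y hg
      (coeff_univariate_nonneg v fun _ => ENNReal.toReal_nonneg), ofReal_univariate]
  | ite v n P₁ P₂ ih₁ ih₂ =>
    have h₁ := coeff_restrict_nonneg hg v n
    have h₂ := coeff_sub_restrict_nonneg hg v n
    rw [realPm, gfPm, FPS.ofReal_add (coeff_realPm_nonneg P₁ hP.1 h₁)
      (coeff_realPm_nonneg P₂ hP.2 h₂), ih₁ hP.1 h₁, ih₂ hP.2 h₂, ofReal_restrict,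
      ofReal_sub_restrict]
  | seq P₁ P₂ ih₁ ih₂ =>
    rw [realPm, gfPm, ih₂ hP.2 (coeff_realPm_nonneg P₁ hP.1 hg), ih₁ hP.1 hg]
  | _ => exact hP.elim

/-! ### The semantics over `ℝ≥0∞` computes posterior measures -/

theorem restrict_eq_indicator (v : V) (n : ℕ) (g : MvPowerSeries V ℝ≥0∞) :
    restrict v n g = Set.indicator {s : State V | s v < n} g := by
  classical
  funext s
  exact (coeff_restrict_ennreal v n g s).trans
    (Set.indicator_apply {s : State V | s v < n} g s).symm

theorem restrictCompl_eq_indicator (v : V) (n : ℕ) (g : MvPowerSeries V ℝ≥0∞) :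
    restrictCompl v n g = Set.indicator {s : State V | s v < n}ᶜ g := by
  classical
  funext s
  refine (coeff_restrictCompl v n g s).trans ?_
  split_ifs with h
  · exact (Set.indicator_of_notMem (s := {s : State V | s v < n}ᶜ) (fun hs => hs h) g).symm
  · exact (Set.indicator_of_mem (s := {s : State V | s v < n}ᶜ) h g).symm

theorem pm_decr (v : V) (g : MvPowerSeries V ℝ≥0∞) :
    (toPGCL (.decr v)).pm g = (decr v).gfPm g := by
  classical
  funext s
  change ∑' s' : State V, (if s'.update v (s' v - 1) = s then 1 else 0) *
      MvPowerSeries.coeff s' g =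
    MvPowerSeries.coeff s (shiftDown v (restrictCompl v 1 g) + restrict v 1 g)
  rw [map_add, coeff_shiftDown, coeff_restrictCompl, coeff_restrict_ennreal]
  -- The only possible predecessors of `s` are `s[v ↦ s v + 1]` and, if `s v = 0`, `s` itself.
  have hne : s.update v (s v + 1) ≠ s := fun h => by
    simpa [Finsupp.update_apply] using DFunLike.congr_fun h v
  rw [tsum_eq_sum (s := {s.update v (s v + 1), s}), Finset.sum_pair hne]
  · congr 1
    · simp [Finsupp.update_apply, Finsupp.update_idem, Finsupp.update_self]
    · by_cases h : s v = 0
      · rw [if_pos (by rw [h, Nat.zero_sub, ← h, Finsupp.update_self]), if_pos (by omega), one_mul]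
      · rw [if_neg, if_neg (by omega), zero_mul]
        intro h'
        have := DFunLike.congr_fun h' v
        simp [Finsupp.update_apply] at this
        omega
  · intro s' hs'
    rw [if_neg, zero_mul]
    rintro rfl
    simp only [Finset.mem_insert, Finset.mem_singleton, Finsupp.update_apply, if_true,
      Finsupp.update_idem, not_or] at hs'
    rcases Nat.eq_zero_or_pos (s' v) with h | h
    · refine hs'.2 ?_
      rw [h, Nat.zero_sub, ← h, Finsupp.update_self]
    · refine hs'.1 ?_
      rw [Nat.sub_add_cancel h, Finsupp.update_self]

theorem pm_incr_apply (v : V) (D : PMF ℕ) (y : V) (g : StateMeasure V) (s : State V) :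
    (toPGCL (.incr v D y)).pm g s =
      ∑ j ∈ Finset.range (s v + 1),
        g (s.update v j) * iidSum D (s.update v j y) (s v - j) := by
  classical
  change ∑' s' : State V, (if s'.update v (s v) = s then 1 else 0) *
    ((iidSum D (s' y)).map fun b => s' v + b) (s v) * g s' = _
  have hmap (s' : State V) : ((iidSum D (s' y)).map fun b => s' v + b) (s v) =
      if s' v ≤ s v then iidSum D (s' y) (s v - s' v) else 0 := by
    rw [PMF.map_apply]
    split_ifs with h
    · rw [tsum_eq_single (s v - s' v), if_pos (by omega)]
      intro b hb
      rw [if_neg (by omega)]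
    · exact ENNReal.tsum_eq_zero.2 fun b => if_neg (by omega)
  have hinj : Set.InjOn (fun j => s.update v j) (Finset.range (s v + 1)) := fun i _ j _ h => by
    simpa [Finsupp.update_apply] using DFunLike.congr_fun h v
  rw [tsum_eq_sum (s := (Finset.range (s v + 1)).image fun j => s.update v j),
    Finset.sum_image hinj]
  · refine Finset.sum_congr rfl fun j hj => ?_
    have hv : (s.update v j) v = j := by simp [Finsupp.update_apply]
    rw [Finset.mem_range] at hj
    rw [hmap, hv, Finsupp.update_idem, Finsupp.update_self, if_pos rfl,
      if_pos (Nat.le_of_lt_succ hj), one_mul, mul_comm]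
  · intro s' hs'
    rw [hmap]
    split_ifs with h₁ h₂
    · refine absurd (Finset.mem_image.2 ⟨s' v, Finset.mem_range.2 (by omega), ?_⟩) hs'
      rw [← h₁, Finsupp.update_idem, Finsupp.update_self]
    all_goals simp

/-- Both sides sum the initial mass of `s[v ↦ j]` times the probability that the samples add up to
`s v - j`, over `j ≤ s v`. -/
theorem pm_incr (v : V) (D : PMF ℕ) (y : V) (g : StateMeasure V) :
    (toPGCL (.incr v D y)).pm g = (incr v D y).gfPm g := by
  classical
  funext s
  rw [pm_incr_apply]
  refine Eq.trans ?_ (coeff_substVar_X_mul y g _ s).symm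
  rw [← Finset.sum_product']
  -- With `k` the value of `y` in `s[v ↦ j]`, the factor `X_y ^ k` of `X ^ (s[v ↦ j])` is replaced
  -- by a power whose monomial `X_y ^ k * X_v ^ (s v - j)` leads to `X ^ s`.
  refine Finset.sum_of_injOn (fun j => (((s.update v j).update y 0,
    Finsupp.single y (s.update v j y) + Finsupp.single v (s v - j)), s.update v j y)) ?_ ?_ ?_ ?_
  · intro i _ j _ h
    simp only [Prod.mk.injEq] at h
    have h' := congrArg (fun t : State V => t.update y (s.update v i y)) h.1.1
    simp only [Finsupp.update_idem, Finsupp.update_self] at h'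
    rw [h.2, Finsupp.update_self] at h'
    simpa [Finsupp.update_apply] using DFunLike.congr_fun h' v
  · intro j hj
    simp only [Finset.coe_range, Set.mem_Iio] at hj
    simp only [Finset.coe_product, Set.mem_prod, Finset.mem_coe, Finset.mem_filter,
      Finset.HasAntidiagonal.mem_antidiagonal, Finset.mem_range]
    refine ⟨⟨?_, ?_⟩, ?_⟩
    · ext w
      simp only [Finsupp.add_apply, Finsupp.update_apply, Finsupp.single_apply]
      grind
    · simp only [Finsupp.add_apply, Finsupp.update_apply, Finsupp.single_apply]
      grind
    · simp only [Finsupp.update_apply]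
      grind
  · rintro ⟨⟨a, b⟩, k⟩ h hnot
    simp only [Finset.mem_product, Finset.mem_filter,
      Finset.HasAntidiagonal.mem_antidiagonal, Finset.mem_range] at h
    rw [coeff_X_mul_univariate_pow_eq_zero, mul_zero]
    intro m hm
    obtain rfl : b = Finsupp.single y k + Finsupp.single v m := hm
    obtain ⟨⟨rfl, hy⟩, -⟩ := h
    have ha : a y = 0 := by simpa using hy
    set c : State V := a + Finsupp.single y k with hc
    rw [← add_assoc, ← hc] at hnot
    have hv : (c + Finsupp.single v m) v = c v + m := by simp
    have hupd : (c + Finsupp.single v m).update v (c v) = c := by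
      ext w
      by_cases hw : w = v <;> simp [Finsupp.update_apply, hw]
    have hk : c y = k := by simp [hc, ha]
    have ha' : c.update y 0 = a := by
      ext w
      by_cases hw : w = y <;> simp [Finsupp.update_apply, hc, hw, ha]
    refine hnot ⟨c v, by simp only [hv, Finset.coe_range, Set.mem_Iio]; omega, ?_⟩
    simp only [hv, hupd, hk, ha', Nat.add_sub_cancel_left]
  · intro j _
    dsimp only
    rw [coeff_X_mul_univariate_pow, Finsupp.update_idem, Finsupp.update_self]
    rfl

theorem pm_toPGCL_eq_gfPm (P : ReDiP V) (hP : P.IsClosed) (g : StateMeasure V) :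
    P.toPGCL.pm g = P.gfPm g := by
  induction P generalizing g with
  | assign v n => exact hP.elim
  | decr v => exact pm_decr v g
  | incr v D y => exact pm_incr v D y g
  | ite v n P₁ P₂ ih₁ ih₂ =>
    change P₁.toPGCL.pm _ + P₂.toPGCL.pm _ = P₁.gfPm _ + P₂.gfPm _
    rw [ih₁ hP.1, ih₂ hP.2]
    exact congrArg₂ (fun a b => P₁.gfPm a + P₂.gfPm b) (restrict_eq_indicator v n g).symm
      (restrictCompl_eq_indicator v n g).symm
  | seq P₁ P₂ ih₁ ih₂ =>
    change P₂.toPGCL.pm (P₁.toPGCL.pm g) = P₂.gfPm (P₁.gfPm g)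
    rw [ih₂ hP.2, ih₁ hP.1]
  | _ => exact hP.elim

end ReDiP

theorem mainTheorem7 {V T : Type*} [Finite V] [Finite T]
    (v : V) (n : ℕ) (P₀ : ReDiP V) (hP₀ : P₀.IsClosed)
    (μ : StateMeasure V) (hμ : FPS.HasRationalClosedForm (FPS.ofMeasure μ))
    (I : RationalTemplate V T) (τ : T → ℝ) (hτ : I.IsWellDefinedAt τ)
    (hfix : ReDiP.realCharFun v n P₀ hP₀ (FPS.toReal (FPS.ofMeasure μ)) (I.inst τ) = I.inst τ)
    (hnonneg : ∀ s, 0 ≤ MvPowerSeries.coeff s (I.inst τ)) :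
    PGCL.IsOccupationInvariant {s | s v < n} P₀.toPGCL μ
        (FPS.toMeasure (FPS.ofReal (I.inst τ))) ∧
      ReDiP.gfCharFun v n P₀ (FPS.ofMeasure μ) (FPS.ofReal (I.inst τ)) =
        FPS.ofReal (I.inst τ) := by
  have hμ₀ (s : State V) :
      0 ≤ MvPowerSeries.coeff s (FPS.toReal (FPS.ofMeasure μ)) := ENNReal.toReal_nonneg
  have hI := FPS.coeff_restrict_nonneg hnonneg v n
  have hgf : ReDiP.gfCharFun v n P₀ (FPS.ofMeasure μ) (FPS.ofReal (I.inst τ)) =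
      FPS.ofReal (I.inst τ) := by
    conv_rhs => rw [← hfix]
    rw [ReDiP.realCharFun, ReDiP.gfCharFun,
      FPS.ofReal_add hμ₀ (ReDiP.coeff_realPm_nonneg P₀ hP₀ hI),
      ReDiP.ofReal_realPm P₀ hP₀ hI, FPS.ofReal_restrict, FPS.ofReal_toReal hμ.1]
  refine ⟨?_, hgf⟩
  rw [PGCL.IsOccupationInvariant, PGCL.charFun, ReDiP.pm_toPGCL_eq_gfPm P₀ hP₀]
  rw [ReDiP.gfCharFun, ReDiP.restrict_eq_indicator] at hgf
  exact hgf
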